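/- Let $G$ be a Lie group acting smoothly, freely and properly from the left on a manifold $M$, such that $\pi\colon M\to \bar M=M/G$ is a (smooth, locally trivial) principal $G$-bundle, and let $\varpi\colon TM\to\mathfrak g$ be the connection map of a principal connection on $\pi$. All manifolds are finite-dimensional, smooth and without boundary; vector fields are smooth; $\tau_N\colon TN\to N$ denotes the projection of a tangent bundle. A vector field $\Gamma$ on $TN$ is a SODE on $N$ if each of its integral curves $\gamma\colon J\to TN$ ($J$ an open interval) is of the form $\gamma=\dot c$ for a curve $c\colon J\to N$. A vector field $X$ on $P$ is an un-reduction, along a smooth map $\mu\colon P\to Q$, of a vector field $\bar X$ on $Q$ if $\mu$ maps every integral curve of $X$ to an integral curve of $\bar X$ (equivalently, $X$ and $\bar X$ are $\mu$-related: $T\mu\circ X=\bar X\circ\mu$). The group $G$ acts on $TM$ by the tangent maps $T\Phi_g$ of the action maps $\Phi_g\colon M\to M$; for $\xi\in\mathfrak g$ let $\xi_{TM}$ be the fundamental vector field of this lifted action, that is, the complete lift of the fundamental vector field of $\xi$ on $M$. Let $\varpi^V=\tau_M^*\varpi\colon TTM\to\mathfrak g$, that is, $\varpi^V(W)=\varpi(T\tau_M(W))$,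 and let $\Omega$ be the corresponding $(1,1)$-tensor field on $TM$, $\Omega(W)=\big(\varpi^V(W)\big)_{TM}(v)$ for $W\in T_v(TM)$. Finally let $X_\omega$ be the vector field on $TM$ given by $X_\omega(v)=\big(\varpi(v)\big)_{TM}(v)$; it equals $\Omega(\Gamma_0)$ for every SODE $\Gamma_0$ on $M$. **Proposition.** Let $\bar\Gamma$ be a vector field on $T(M/G)$ and let $\Gamma$ be a vector field on $TM$ that is an un-reduction of $\bar\Gamma$ along $T\pi\colon TM\to T(M/G)$. 1. If $\Gamma$ is a SODE on $M$, then $\bar\Gamma$ is a SODE on $M/G$. 2. If $\bar\Gamma$ is a SODE on $M/G$, then $\Gamma$ is a SODE on $M$ if and only if $\varpi^V\circ\Gamma=\varpi$. 3. If $\bar\Gamma$ is a SODE on $M/G$, then $\Gamma$ is a SODE on $M$ if and only if $\Omega(\Gamma)=X_\omega$. -/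

import Mathlib

open scoped Manifold ContDiff

noncomputable section

/-! ### Vector fields, their integral curves, SODEs and un-reductions -/

section VectorFields

variable {E : Type*} [NormedAddCommGroup E] [NormedSpace ℝ E]
  {H : Type*} [TopologicalSpace H] (I : ModelWithCorners ℝ E H)
  {P : Type*} [TopologicalSpace P] [ChartedSpace H P] [IsManifold I ∞ P]
  {E' : Type*} [NormedAddCommGroup E'] [NormedSpace ℝ E']
  {H' : Type*} [TopologicalSpace H'] (I' : ModelWithCorners ℝ E' H')
  {Q : Type*} [TopologicalSpace Q] [ChartedSpace H' Q] [IsManifold I' ∞ Q]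

/-- The assignment `X` of a tangent vector to each point of `P` is a smooth vector field. -/
def IsSmoothVectorField (X : (p : P) → TangentSpace I p) : Prop :=
  ContMDiff I I.tangent ∞ (fun p => (⟨p, X p⟩ : TangentBundle I P))

/-- The velocity `ċ(t)`, as a point of the tangent bundle, of a curve `c`. -/
def velocity (c : ℝ → P) (t : ℝ) : TangentBundle I P :=
  tangentMap 𝓘(ℝ, ℝ) I c ⟨t, (1 : ℝ)⟩

/-- A vector field `Γ` on `TP` is a second-order differential equation field (SODE) on `P`
if every integral curve `γ : J → TP` of `Γ` (`J` an open interval) is a lifted curve,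
i.e. `γ = ċ` for some differentiable curve `c : J → P`. -/
def IsSODE (Γ : (v : TangentBundle I P) → TangentSpace I.tangent v) : Prop :=
  ∀ (J : Set ℝ) (γ : ℝ → TangentBundle I P), IsOpen J → J.OrdConnected →
    IsMIntegralCurveOn γ Γ J →
    ∃ c : ℝ → P, ∀ t ∈ J, MDifferentiableAt 𝓘(ℝ, ℝ) I c t ∧ γ t = velocity I c t

/-- A vector field `X` on `P` is an un-reduction, along `μ : P → Q`, of a vector field `Y`
on `Q` if `μ` maps every integral curve of `X` to an integral curve of `Y`. -/
def IsUnreduction (μ : P → Q) (X : (p : P) → TangentSpace I p)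
    (Y : (q : Q) → TangentSpace I' q) : Prop :=
  ∀ (J : Set ℝ) (γ : ℝ → P), IsOpen J → J.OrdConnected →
    IsMIntegralCurveOn γ X J → IsMIntegralCurveOn (μ ∘ γ) Y J

end VectorFields

/-! ### Lie group actions, principal bundles and principal connections -/

section Actions

variable {EG : Type*} [NormedAddCommGroup EG] [NormedSpace ℝ EG]
  {HG : Type*} [TopologicalSpace HG] (IG : ModelWithCorners ℝ EG HG)
  {G : Type*} [TopologicalSpace G] [ChartedSpace HG G] [Group G]
  {E : Type*} [NormedAddCommGroup E] [NormedSpace ℝ E]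
  {H : Type*} [TopologicalSpace H] (I : ModelWithCorners ℝ E H)
  {M : Type*} [TopologicalSpace M] [ChartedSpace H M]
  {EB : Type*} [NormedAddCommGroup EB] [NormedSpace ℝ EB]
  {HB : Type*} [TopologicalSpace HB] (IB : ModelWithCorners ℝ EB HB)
  {B : Type*} [TopologicalSpace B] [ChartedSpace HB B]

/-- The adjoint representation: `Ad g` is the differential at `1` of `h ↦ g * h * g⁻¹`
(which fixes `1`). -/
def adjointRep (g : G) (ξ : GroupLieAlgebra IG G) : GroupLieAlgebra IG G :=
  mfderiv IG IG (fun h : G => g * h * g⁻¹) 1 ξ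

/-- The value at `p` of the fundamental vector field of `ξ` for a (left) action `Φ` of `G`:
the differential at `1` of `g ↦ Φ g p`, applied to `ξ`. (As `Φ 1 p = p`, this is a tangent vector
at `p`.) -/
def fundamentalField (Φ : G → M → M) (ξ : GroupLieAlgebra IG G) (p : M) : TangentSpace I p :=
  mfderiv IG I (fun g : G => Φ g p) 1 ξ

variable [SMul G M]

/-- The lift `Φ^{TM}_g = T(Φ_g)` of the action of `G` on `M` to an action of `G` on `TM`. -/
def tangentAction (g : G) (v : TangentBundle I M) : TangentBundle I M :=
  tangentMap I I (fun m : M => g • m) v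

variable (G) in
/-- `π : M → B` is a smooth (left) principal `G`-bundle, for the given smooth action of `G` on `M`:
the action is free and proper, `π` induces a bijection of `M / G` with `B`, and `B` is covered by
open sets over which `π` is `G`-equivariantly diffeomorphic to the trivial bundle. In particular
`B` is the manifold `M / G`, with `π` as its quotient map. -/
structure IsPrincipalBundle (π : M → B) : Prop where
  free : ∀ (g : G) (m : M), g • m = m → g = 1
  proper : IsProperMap (fun q : G × M => (q.1 • q.2, q.2))
  surjective : Function.Surjective π
  fibre : ∀ m m' : M, π m = π m' ↔ ∃ g : G, g • m = m'
  locallyTrivial : ∀ b : B, ∃ e : Bundle.Trivialization G π, b ∈ e.baseSet ∧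
    ContMDiffOn I (IB.prod IG) ∞ e e.source ∧
    ContMDiffOn (IB.prod IG) I ∞ e.toOpenPartialHomeomorph.symm e.target ∧
    ∀ (g : G) (m : M), π m ∈ e.baseSet → e (g • m) = (π m, g * (e m).2)

variable [IsManifold I ∞ M]

variable (G M) in
/-- A principal connection, given by its connection map `ϖ : TM → 𝔤`: a smooth `𝔤`-valued one-form
which reproduces the generators of the fundamental vector fields and is `Ad`-equivariant. -/
structure PrincipalConnection where
  /-- the connection map `ϖ` -/
  form : (m : M) → TangentSpace I m →L[ℝ] GroupLieAlgebra IG G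
  smooth : ContMDiff (M' := EG) I.tangent 𝓘(ℝ, EG) ∞
    (fun v : TangentBundle I M => form v.proj v.2)
  form_fundamentalField : ∀ (m : M) (ξ : GroupLieAlgebra IG G),
    form m (fundamentalField IG I (fun (g : G) (m : M) => g • m) ξ m) = ξ
  equivariant : ∀ (g : G) (m : M) (v : TangentSpace I m),
    form (g • m) (mfderiv I I (fun m : M => g • m) m v) = adjointRep IG g (form m v)

namespace PrincipalConnection

variable {IG I}
variable (ϖ : PrincipalConnection IG G I M)

/-- The connection map `ϖ^V = τ_M^* ϖ : TTM → 𝔤` of the vertical connection, a principal connection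
on `TM → (TM)/G`. Here `τ_M : TM → M` is the bundle projection. -/
def verticalForm (v : TangentBundle I M) (W : TangentSpace I.tangent v) : GroupLieAlgebra IG G :=
  ϖ.form v.proj (mfderiv I.tangent I (Bundle.TotalSpace.proj : TangentBundle I M → M) v W)

/-- The `(1,1)`-tensor field `Ω` on `TM` of the vertical connection (its vertical projection
operator): `Ω(W) = (ϖ^V(W))_{TM}(v)` for `W ∈ T_v(TM)`, where `ξ_{TM}` is the fundamental vector
field of `ξ` for the lifted action of `G` on `TM` (equivalently, the complete lift of the
fundamental vector field of `ξ` on `M`). -/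
def verticalProjection (v : TangentBundle I M) (W : TangentSpace I.tangent v) :
    TangentSpace I.tangent v :=
  fundamentalField IG I.tangent (fun (g : G) (v : TangentBundle I M) => tangentAction I g v)
    (ϖ.verticalForm v W) v

/-- The vector field `X_ω` on `TM`, given pointwise by `X_ω(v) = (ϖ(v))_{TM}(v)`. It is `Ω(Γ₀)` for
every SODE `Γ₀`, see `PrincipalConnection.verticalProjection_of_isSODE`. -/
def fieldX (v : TangentBundle I M) : TangentSpace I.tangent v :=
  fundamentalField IG I.tangent (fun (g : G) (v : TangentBundle I M) => tangentAction I g v)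
    (ϖ.form v.proj v.2) v

end PrincipalConnection

end Actions

section Facts

variable {E : Type*} [NormedAddCommGroup E] [NormedSpace ℝ E]
  {H : Type*} [TopologicalSpace H] {I : ModelWithCorners ℝ E H}
  {M : Type*} [TopologicalSpace M] [ChartedSpace H M] [IsManifold I ∞ M]

/-- A SODE satisfies `Tτ_M ∘ Γ = id`. -/
theorem IsSODE.mfderiv_proj [CompleteSpace E] [I.Boundaryless]
    {Γ : (v : TangentBundle I M) → TangentSpace I.tangent v}
    (hΓ : IsSmoothVectorField I.tangent Γ) (h : IsSODE I Γ) (v : TangentBundle I M) :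
    mfderiv I.tangent I (Bundle.TotalSpace.proj : TangentBundle I M → M) v (Γ v) = v.2 := by
  obtain ⟨γ, hγ0, hγ⟩ := exists_isMIntegralCurveAt_of_contMDiffAt_boundaryless (0 : ℝ)
    ((hΓ v).of_le (by exact_mod_cast le_top))
  obtain ⟨ε, hε, hγ'⟩ := isMIntegralCurveAt_iff'.1 hγ
  have h0 : (0 : ℝ) ∈ Metric.ball (0 : ℝ) ε := Metric.mem_ball_self hε
  obtain ⟨c, hc⟩ := h _ γ Metric.isOpen_ball (convex_ball _ _).ordConnected hγ'
  have heq : (fun t => (γ t).proj) =ᶠ[nhds 0] c := by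
    filter_upwards [Metric.ball_mem_nhds (0 : ℝ) hε] with t ht
    rw [(hc t ht).2]
    rfl
  have hp : MDifferentiableAt I.tangent I (Bundle.TotalSpace.proj : TangentBundle I M → M) (γ 0) :=
    ((Bundle.contMDiff_proj (n := 1) (IB := I) (TangentSpace I : M → Type _)) _).mdifferentiableAt
      one_ne_zero
  have h1 := (hp.hasMFDerivAt.comp (0 : ℝ) hγ.hasMFDerivAt).congr_of_eventuallyEq heq.symm
  have h2 : γ 0 = ⟨c 0, mfderiv 𝓘(ℝ, ℝ) I c 0 (1 : ℝ)⟩ := (hc 0 h0).2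
  have h3 : mfderiv 𝓘(ℝ, ℝ) I c 0 (1 : ℝ) =
      mfderiv I.tangent I (Bundle.TotalSpace.proj : TangentBundle I M → M) (γ 0) (Γ (γ 0)) := by
    rw [h1.mfderiv]
    exact congrArg _ (one_smul ℝ (Γ (γ 0)))
  have h4 : (mfderiv I.tangent I (Bundle.TotalSpace.proj : TangentBundle I M → M) (γ 0) (Γ (γ 0)) : E) =
      (γ 0).2 := by
    refine h3.symm.trans ?_
    rw [h2]
  rw [hγ0] at h4
  exact h4

/-- The defining property of `X_ω`: it is `Ω(Γ₀)`, whichever the SODE `Γ₀`. -/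
theorem PrincipalConnection.verticalProjection_of_isSODE [CompleteSpace E] [I.Boundaryless]
    {EG : Type*} [NormedAddCommGroup EG] [NormedSpace ℝ EG]
    {HG : Type*} [TopologicalSpace HG] {IG : ModelWithCorners ℝ EG HG}
    {G : Type*} [TopologicalSpace G] [ChartedSpace HG G] [Group G] [SMul G M]
    (ϖ : PrincipalConnection IG G I M)
    {Γ₀ : (v : TangentBundle I M) → TangentSpace I.tangent v}
    (hΓ₀ : IsSmoothVectorField I.tangent Γ₀) (h : IsSODE I Γ₀) (v : TangentBundle I M) :
    ϖ.verticalProjection v (Γ₀ v) = ϖ.fieldX v := by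
  unfold PrincipalConnection.verticalProjection PrincipalConnection.fieldX
    PrincipalConnection.verticalForm
  rw [h.mfderiv_proj hΓ₀ v]

end Facts

end

/-! Everything becomes pointwise. Integral curves exist through every point, so a smooth field `Γ`
on `TN` is a SODE exactly when `Tτ_N ∘ Γ = id` (`isSODE_iff_mfderiv_proj`), and an un-reduction
along `Tπ` is `Tπ`-related to the field below (`IsUnreduction.mfderiv_apply`). Differentiating `τ_B
∘ Tπ = π ∘ τ_M` then gives `Tτ_B(Γbar(Tπ v)) = Tπ(Tτ_M(Γ v))`.

If `Γ` is a SODE, the right side is `Tπ v`, and surjectivity of `Tπ` gives part 1. If `Γbar` is a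
SODE, then `Tτ_M(Γ v)` and `v` are tangent at the same point and have equal images under `Tπ`, so
they differ by a vertical vector. Vertical vectors are values of fundamental fields
(`exists_fundamentalField_eq`), on which `ϖ` is injective; hence the two agree as soon as their
`ϖ`-values do, which is part 2. Part 3 is equivalent to part 2 because `ϖ^V` recovers `ξ` from
`ξ_{TM}(v)`. -/

section SODE

variable {E : Type*} [NormedAddCommGroup E] [NormedSpace ℝ E]
  {H : Type*} [TopologicalSpace H] {I : ModelWithCorners ℝ E H}
  {M : Type*} [TopologicalSpace M] [ChartedSpace H M] [IsManifold I ∞ M]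

/-- The projection of a tangent bundle is differentiable. -/
theorem mdifferentiableAt_tangentBundle_proj (v : TangentBundle I M) :
    MDifferentiableAt I.tangent I (Bundle.TotalSpace.proj : TangentBundle I M → M) v :=
  ((Bundle.contMDiff_proj (n := 1) (IB := I) (TangentSpace I : M → Type _)) v).mdifferentiableAt
    one_ne_zero

/-- A vector field `Γ` on `TM` with `Tτ_M ∘ Γ = id` is a SODE. -/
theorem isSODE_of_mfderiv_proj {Γ : (v : TangentBundle I M) → TangentSpace I.tangent v}
    (h : ∀ v : TangentBundle I M,
      mfderiv I.tangent I (Bundle.TotalSpace.proj : TangentBundle I M → M) v (Γ v) = v.2) :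
    IsSODE I Γ := by
  intro J γ hJ _ hγ
  refine ⟨fun t => (γ t).proj, fun t ht => ?_⟩
  have h1 := (mdifferentiableAt_tangentBundle_proj (γ t)).hasMFDerivAt.comp t
    ((hγ t ht).hasMFDerivAt (hJ.mem_nhds ht))
  refine ⟨h1.mdifferentiableAt, ?_⟩
  have h2 : mfderiv 𝓘(ℝ, ℝ) I (fun t => (γ t).proj) t (1 : ℝ) = (γ t).2 := by
    refine (congrArg (fun L => L (1 : ℝ)) h1.mfderiv).trans (Eq.trans ?_ (h (γ t)))
    -- The derivative of an integral curve is the map `s ↦ s • Γ (γ t)`, here evaluated at `s = 1`.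
    exact congrArg _ (one_smul ℝ (Γ (γ t)))
  change γ t = ⟨(γ t).proj, mfderiv 𝓘(ℝ, ℝ) I (fun t => (γ t).proj) t (1 : ℝ)⟩
  rw [h2]

/-- A smooth vector field on `TM` is a SODE if and only if it is a section of `Tτ_M`. -/
theorem isSODE_iff_mfderiv_proj [CompleteSpace E] [I.Boundaryless]
    {Γ : (v : TangentBundle I M) → TangentSpace I.tangent v}
    (hΓ : IsSmoothVectorField I.tangent Γ) :
    IsSODE I Γ ↔ ∀ v : TangentBundle I M,
      mfderiv I.tangent I (Bundle.TotalSpace.proj : TangentBundle I M → M) v (Γ v) = v.2 :=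
  ⟨fun h v => h.mfderiv_proj hΓ v, isSODE_of_mfderiv_proj⟩

end SODE

/-! ### Relatedness of vector fields, and naturality of the tangent projection. -/

section Unreduction

variable {E : Type*} [NormedAddCommGroup E] [NormedSpace ℝ E]
  {H : Type*} [TopologicalSpace H] {I : ModelWithCorners ℝ E H}
  {P : Type*} [TopologicalSpace P] [ChartedSpace H P]
  {E' : Type*} [NormedAddCommGroup E'] [NormedSpace ℝ E']
  {H' : Type*} [TopologicalSpace H'] {I' : ModelWithCorners ℝ E' H'}
  {Q : Type*} [TopologicalSpace Q] [ChartedSpace H' Q]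

/-- An un-reduction of `Y` along `μ` is `μ`-related to `Y`. -/
theorem IsUnreduction.mfderiv_apply [CompleteSpace E] [I.Boundaryless] [IsManifold I ∞ P]
    {μ : P → Q} {X : (p : P) → TangentSpace I p} {Y : (q : Q) → TangentSpace I' q}
    (h : IsUnreduction I I' μ X Y) (hX : IsSmoothVectorField I X) {p : P}
    (hμ : MDifferentiableAt I I' μ p) :
    mfderiv I I' μ p (X p) = Y (μ p) := by
  have : IsManifold I 1 P := .of_le (n := ∞) (by exact_mod_cast le_top)
  -- The hypothesis only speaks of curves, so it is tested on an integral curve through `p`;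
  -- comparing two expressions for the velocity of `μ ∘ γ` at time `0` gives the claim.
  obtain ⟨γ, hγ0, hγ⟩ := exists_isMIntegralCurveAt_of_contMDiffAt_boundaryless (0 : ℝ)
    ((hX p).of_le (by exact_mod_cast le_top))
  obtain ⟨ε, hε, hγ'⟩ := isMIntegralCurveAt_iff'.1 hγ
  have h0 : (0 : ℝ) ∈ Metric.ball (0 : ℝ) ε := Metric.mem_ball_self hε
  subst hγ0
  have h1 := (h _ γ Metric.isOpen_ball (convex_ball _ _).ordConnected hγ' 0 h0).hasMFDerivAt
    (Metric.isOpen_ball.mem_nhds h0)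
  have h2 := hμ.hasMFDerivAt.comp (0 : ℝ) hγ.hasMFDerivAt
  have h3 := congrArg (fun L => L (1 : ℝ)) (hasMFDerivAt_unique h2 h1)
  calc mfderiv I I' μ (γ 0) (X (γ 0))
      = mfderiv I I' μ (γ 0) ((1 : ℝ) • X (γ 0)) := by rw [one_smul]
    _ = (1 : ℝ) • Y (μ (γ 0)) := h3
    _ = Y (μ (γ 0)) := one_smul _ _

/-- `Tτ_Q ∘ TTμ = Tμ ∘ Tτ_P`. -/
theorem mfderiv_proj_mfderiv_tangentMap [IsManifold I ∞ P] [IsManifold I' ∞ Q] {μ : P → Q}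
    (hμ : ContMDiff I I' ∞ μ) (v : TangentBundle I P) (W : TangentSpace I.tangent v) :
    mfderiv I'.tangent I' (Bundle.TotalSpace.proj : TangentBundle I' Q → Q) (tangentMap I I' μ v)
        (mfderiv I.tangent I'.tangent (tangentMap I I' μ) v W) =
      mfderiv I I' μ v.proj
        (mfderiv I.tangent I (Bundle.TotalSpace.proj : TangentBundle I P → P) v W) := by
  have hT : MDifferentiableAt I.tangent I'.tangent (tangentMap I I' μ) v :=
    (hμ.contMDiff_tangentMap (m := ∞) le_rfl v).mdifferentiableAt (by simp)
  have h1 := (mdifferentiableAt_tangentBundle_proj (tangentMap I I' μ v)).hasMFDerivAt.comp v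
    hT.hasMFDerivAt
  have h2 := ((hμ v.proj).mdifferentiableAt (by simp)).hasMFDerivAt.comp v
    (mdifferentiableAt_tangentBundle_proj v).hasMFDerivAt
  -- Both are derivatives of one map, since `τ_Q ∘ Tμ` and `μ ∘ τ_P` agree by definition.
  exact congrArg (fun L => L W) (hasMFDerivAt_unique h1 h2)

end Unreduction

/-! ### Local sections and vertical vectors of a principal bundle. -/

section PrincipalBundle

variable {EG : Type*} [NormedAddCommGroup EG] [NormedSpace ℝ EG]
  {HG : Type*} [TopologicalSpace HG] {IG : ModelWithCorners ℝ EG HG}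
  {G : Type*} [TopologicalSpace G] [ChartedSpace HG G] [Group G]
  {E : Type*} [NormedAddCommGroup E] [NormedSpace ℝ E]
  {H : Type*} [TopologicalSpace H] {I : ModelWithCorners ℝ E H}
  {M : Type*} [TopologicalSpace M] [ChartedSpace H M]
  {EB : Type*} [NormedAddCommGroup EB] [NormedSpace ℝ EB]
  {HB : Type*} [TopologicalSpace HB] {IB : ModelWithCorners ℝ EB HB}
  {B : Type*} [TopologicalSpace B] [ChartedSpace HB B]
  {π : M → B}

namespace IsPrincipalBundle

/-- The projection of a principal bundle is smooth. -/
theorem contMDiff [SMul G M] (hπ : IsPrincipalBundle IG G I IB π) : ContMDiff I IB ∞ π := by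
  intro m
  obtain ⟨e, hb, he, -, -⟩ := hπ.locallyTrivial (π m)
  have hm : m ∈ e.source := e.mem_source.2 hb
  have h1 := contMDiffAt_fst.comp m (he.contMDiffAt (e.open_source.mem_nhds hm))
  refine h1.congr_of_eventuallyEq ?_
  filter_upwards [e.open_source.mem_nhds hm] with m' hm'
  exact (e.coe_fst hm').symm

/-- A principal bundle has a smooth local section through each point. -/
theorem exists_contMDiffAt_section [SMul G M] (hπ : IsPrincipalBundle IG G I IB π) (m : M) :
    ∃ s : B → M, ContMDiffAt IB I ∞ s (π m) ∧ s (π m) = m ∧ ∀ᶠ b in nhds (π m), π (s b) = b := by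
  obtain ⟨e, hb, -, he, -⟩ := hπ.locallyTrivial (π m)
  have hm : m ∈ e.source := e.mem_source.2 hb
  have htarget : (π m, (e m).2) ∈ e.target := e.mem_target.2 hb
  -- Freezing the group coordinate at that of `m` makes the section pass through `m`.
  refine ⟨fun b => e.toOpenPartialHomeomorph.symm (b, (e m).2), ?_, ?_, ?_⟩
  · exact (he.contMDiffAt (e.open_target.mem_nhds htarget)).comp (π m)
      (contMDiffAt_id.prodMk contMDiffAt_const)
  · exact e.symm_apply_mk_proj hm
  · filter_upwards [e.open_baseSet.mem_nhds hb] with b hb'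
    exact e.proj_symm_apply' hb'

/-- The projection of a principal bundle is a submersion. -/
theorem mfderiv_surjective [SMul G M] (hπ : IsPrincipalBundle IG G I IB π) (m : M) :
    Function.Surjective (mfderiv I IB π m) := by
  obtain ⟨s, hs, hsm, hsec⟩ := hπ.exists_contMDiffAt_section m
  have h2 : HasMFDerivAt IB I s (π m) (mfderiv IB I s (π m)) :=
    (hs.mdifferentiableAt (by simp)).hasMFDerivAt
  have h1 := ((hπ.contMDiff (s (π m))).mdifferentiableAt (by simp)).hasMFDerivAt.comp (π m) h2
  have h3 := hasMFDerivAt_unique h1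
    ((hasMFDerivAt_id (I := IB) (π m)).congr_of_eventuallyEq hsec)
  rw [hsm] at h3
  intro w
  exact ⟨mfderiv IB I s (π m) w, congrArg (fun L => L w) h3⟩

/-- The tangent map of the projection of a principal bundle is surjective. -/
theorem tangentMap_surjective [SMul G M] (hπ : IsPrincipalBundle IG G I IB π) :
    Function.Surjective (tangentMap I IB π) := by
  rintro ⟨b, w⟩
  obtain ⟨m, rfl⟩ := hπ.surjective b
  obtain ⟨v, rfl⟩ := hπ.mfderiv_surjective m w
  exact ⟨⟨m, v⟩, rfl⟩

/-- The vertical vectors of a principal bundle are the values of the fundamental fields. -/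
theorem exists_fundamentalField_eq [LieGroup IG ∞ G] [MulAction G M] [ContMDiffSMul IG I ∞ G M]
    (hπ : IsPrincipalBundle IG G I IB π) {m : M} {w : TangentSpace I m}
    (hw : mfderiv I IB π m w = 0) :
    ∃ ξ : GroupLieAlgebra IG G,
      fundamentalField IG I (fun (g : G) (m : M) => g • m) ξ m = w := by
  obtain ⟨e, hb, he, he', heq⟩ := hπ.locallyTrivial (π m)
  have hm : m ∈ e.source := e.mem_source.2 hb
  have htarget : (π m, (e m).2) ∈ e.target := e.mem_target.2 hb
  -- The section `s` has constant group coordinate `(e m).2`, so `a x` is the element moving `s (π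
  -- x)` to `x`. Differentiating `x = a x • s (π x)` at `m` along a vertical `w` leaves only the
  -- variation of `a`, whence `ξ = da(w)`.
  let a : M → G := fun x => (e x).2 * (e m).2⁻¹
  let s : B → M := fun b => e.toOpenPartialHomeomorph.symm (b, (e m).2)
  have hs : ContMDiffAt IB I ∞ s (π m) := (he'.contMDiffAt (e.open_target.mem_nhds htarget)).comp
    (π m) (contMDiffAt_id.prodMk contMDiffAt_const)
  have hsm : s (π m) = m := e.symm_apply_mk_proj hm
  have ham : a m = 1 := mul_inv_cancel _
  have ha : ContMDiffAt I IG ∞ a m :=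
    (contMDiffAt_snd.comp m (he.contMDiffAt (e.open_source.mem_nhds hm))).mul contMDiffAt_const
  have hdec : (fun x => a x • s (π x)) =ᶠ[nhds m] id := by
    filter_upwards [e.open_source.mem_nhds hm] with x hx
    have hxb : π x ∈ e.baseSet := e.mem_source.1 hx
    have hπs : π (s (π x)) = π x := e.proj_symm_apply' hxb
    have hes : e (s (π x)) = (π x, (e m).2) := e.apply_symm_apply' hxb
    have hfib : π (a x • s (π x)) = π x :=
      ((hπ.fibre (s (π x)) (a x • s (π x))).2 ⟨a x, rfl⟩).symm.trans hπs
    have heq' : e (a x • s (π x)) = e x := by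
      rw [heq (a x) (s (π x)) (hπs.symm ▸ hxb), hes, hπs]
      exact Prod.ext (e.coe_fst hx).symm (inv_mul_cancel_right _ _)
    exact e.injOn (e.mem_source.2 (hfib.symm ▸ hxb)) hx heq'
  have hA : ContMDiff (IG.prod I) I ∞ (fun p : G × M => p.1 • p.2) := contMDiff_smul
  have hd := (ha.mdifferentiableAt (by simp)).hasMFDerivAt.prodMk
    ((hs.mdifferentiableAt (by simp)).hasMFDerivAt.comp m
      ((hπ.contMDiff m).mdifferentiableAt (by simp)).hasMFDerivAt)
  have hcomp := ((hA (a m, s (π m))).mdifferentiableAt (by simp)).hasMFDerivAt.comp m hd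
  have hid := hasMFDerivAt_unique hcomp ((hasMFDerivAt_id (I := I) m).congr_of_eventuallyEq hdec)
  let ξ : GroupLieAlgebra IG G := mfderiv I IG a m w
  have hs0 : mfderiv IB I s (π m) (mfderiv I IB π m w) = 0 := by rw [hw]; exact map_zero _
  have h1 : mfderiv (IG.prod I) I (fun p : G × M => p.1 • p.2) (a m, s (π m))
      ((ξ, mfderiv IB I s (π m) (mfderiv I IB π m w)) : EG × E) = w :=
    congrArg (fun L => L w) hid
  rw [hs0, ham, hsm] at h1
  -- The derivative of the action splits into its two partials; the one in `M` is applied to `0`.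
  have h2 := mfderiv_prod_eq_add_apply (v := ((ξ, 0) : EG × E))
    ((hA ((1 : G), m)).mdifferentiableAt (by simp))
  refine ⟨ξ, Eq.trans ?_ (h2.symm.trans h1)⟩
  let y : E := mfderiv IG I (fun g : G => g • m) 1 ξ
  exact ((congrArg (fun z : E => y + z)
    (map_zero (mfderiv I I (fun z : M => (1 : G) • z) m))).trans (add_zero _)).symm

end IsPrincipalBundle

end PrincipalBundle

/-! ### The lifted action and the vertical connection. -/

section Connection

variable {EG : Type*} [NormedAddCommGroup EG] [NormedSpace ℝ EG]
  {HG : Type*} [TopologicalSpace HG] {IG : ModelWithCorners ℝ EG HG}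
  {G : Type*} [TopologicalSpace G] [ChartedSpace HG G] [Group G] [LieGroup IG ∞ G]
  {E : Type*} [NormedAddCommGroup E] [NormedSpace ℝ E]
  {H : Type*} [TopologicalSpace H] {I : ModelWithCorners ℝ E H}
  {M : Type*} [TopologicalSpace M] [ChartedSpace H M] [IsManifold I ∞ M]
  [MulAction G M] [ContMDiffSMul IG I ∞ G M]

variable (IG I) in
/-- The lifted action on the tangent bundle is smooth in the group variable. -/
theorem contMDiff_tangentAction_left (v : TangentBundle I M) :
    ContMDiff IG I.tangent ∞ (fun g : G => tangentAction I g v) := by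
  have : IsManifold IG 1 G := .of_le (n := ∞) (by exact_mod_cast le_top)
  have : IsManifold I 1 M := .of_le (n := ∞) (by exact_mod_cast le_top)
  have hA : ContMDiff (IG.prod I) I ∞ (fun p : G × M => p.1 • p.2) := contMDiff_smul
  have hT := hA.contMDiff_tangentMap (m := ∞) le_rfl
  have h0 : ContMDiff IG IG.tangent ∞ (fun g : G => (⟨g, 0⟩ : TangentBundle IG G)) :=
    Bundle.contMDiff_zeroSection ℝ (TangentSpace IG : G → Type _)
  have hpair : ContMDiff IG (IG.tangent.prod I.tangent) ∞
      (fun g : G => ((⟨g, 0⟩ : TangentBundle IG G), v)) := h0.prodMk contMDiff_const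
  have hcomp := hT.comp
    ((contMDiff_equivTangentBundleProd_symm (I := IG) (M := G) (I' := I) (M' := M)).comp hpair)
  -- `TΦ_g(v)` is the tangent map of the whole action `G × M → M` at `(0_g, v)`, hence smooth in
  -- `g`.
  refine hcomp.congr fun g => ?_
  have h2 := mfderiv_prod_eq_add_apply (p := (g, v.proj)) (v := ((0, v.2) : EG × E))
    ((hA (g, v.proj)).mdifferentiableAt (by simp))
  refine congrArg (fun z : E => (⟨g • v.proj, z⟩ : TangentBundle I M)) ?_
  refine Eq.symm (Eq.trans h2 ?_)
  let y : E := mfderiv I I (fun x : M => g • x) v.proj v.2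
  exact (congrArg (fun z : E => z + y)
    (map_zero (mfderiv IG I (fun h : G => h • v.proj) g))).trans (zero_add _)

/-- The fundamental fields of the lifted action project to those of the action. -/
theorem mfderiv_proj_fundamentalField (ξ : GroupLieAlgebra IG G) (v : TangentBundle I M) :
    (mfderiv I.tangent I (Bundle.TotalSpace.proj : TangentBundle I M → M) v
      (fundamentalField IG I.tangent
        (fun (g : G) (v : TangentBundle I M) => tangentAction I g v) ξ v) : E) =
      fundamentalField IG I (fun (g : G) (m : M) => g • m) ξ v.proj := by
  have hone : tangentAction I (1 : G) v = v := by
    have h : (fun m : M => (1 : G) • m) = id := funext fun m => one_smul G m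
    rw [tangentAction, h, tangentMap_id, id]
  -- `τ_M(TΦ_g v) = g • τ_M(v)` holds by definition; this is differentiated at `g = 1`, and `hone`
  -- moves the base point from `TΦ_1 v` to `v`.
  have h1 := (mdifferentiableAt_tangentBundle_proj (tangentAction I (1 : G) v)).hasMFDerivAt.comp
    (1 : G) ((contMDiff_tangentAction_left IG I v 1).mdifferentiableAt (by simp)).hasMFDerivAt
  have h2 := congrArg (fun L => L ξ) h1.mfderiv
  rw [hone] at h2
  exact h2.symm

namespace PrincipalConnection

variable (ϖ : PrincipalConnection IG G I M)

/-- The fundamental vectors of the lifted action determine their generators. -/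
theorem verticalForm_fundamentalField (ξ : GroupLieAlgebra IG G) (v : TangentBundle I M) :
    ϖ.verticalForm v (fundamentalField IG I.tangent
      (fun (g : G) (v : TangentBundle I M) => tangentAction I g v) ξ v) = ξ :=
  (congrArg (ϖ.form v.proj) (mfderiv_proj_fundamentalField ξ v)).trans
    (ϖ.form_fundamentalField v.proj ξ)

/-- `Ω(W) = X_ω(v)` if and only if `ϖ^V(W) = ϖ(v)`, for `W ∈ T_v(TM)`. -/
theorem verticalProjection_eq_fieldX_iff (v : TangentBundle I M) (W : TangentSpace I.tangent v) :
    ϖ.verticalProjection v W = ϖ.fieldX v ↔ ϖ.verticalForm v W = ϖ.form v.proj v.2 := by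
  refine ⟨fun h => ?_, fun h => ?_⟩
  · have h' := congrArg (ϖ.verticalForm v) h
    unfold verticalProjection fieldX at h'
    rwa [verticalForm_fundamentalField, verticalForm_fundamentalField] at h'
  · unfold verticalProjection fieldX
    rw [h]

variable {EB : Type*} [NormedAddCommGroup EB] [NormedSpace ℝ EB]
  {HB : Type*} [TopologicalSpace HB] {IB : ModelWithCorners ℝ EB HB}
  {B : Type*} [TopologicalSpace B] [ChartedSpace HB B] {π : M → B}

/-- Tangent vectors with the same projection to the base and the same vertical part agree. -/
theorem eq_of_mfderiv_eq_of_form_eq (hπ : IsPrincipalBundle IG G I IB π) {m : M}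
    {v w : TangentSpace I m} (h : mfderiv I IB π m v = mfderiv I IB π m w)
    (h' : ϖ.form m v = ϖ.form m w) : v = w := by
  obtain ⟨ξ, hξ⟩ := hπ.exists_fundamentalField_eq (w := v - w)
    (by rw [map_sub, h, sub_self])
  have h0 : ξ = 0 := by
    rw [← ϖ.form_fundamentalField m ξ, hξ, map_sub, h', sub_self]
  rw [h0] at hξ
  exact sub_eq_zero.1 (hξ.symm.trans (map_zero (mfderiv IG I (fun g : G => g • m) 1)))

end PrincipalConnection

end Connection

theorem proposition4p2
    -- the Lie group `G`
    {EG : Type*} [NormedAddCommGroup EG] [NormedSpace ℝ EG] [FiniteDimensional ℝ EG]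
    {HG : Type*} [TopologicalSpace HG] (IG : ModelWithCorners ℝ EG HG) [IG.Boundaryless]
    {G : Type*} [TopologicalSpace G] [ChartedSpace HG G] [Group G] [LieGroup IG ∞ G]
    -- the manifold `M`, with a smooth action of `G`
    {E : Type*} [NormedAddCommGroup E] [NormedSpace ℝ E] [FiniteDimensional ℝ E]
    {H : Type*} [TopologicalSpace H] (I : ModelWithCorners ℝ E H) [I.Boundaryless]
    {M : Type*} [TopologicalSpace M] [ChartedSpace H M] [IsManifold I ∞ M]
    [MulAction G M] [ContMDiffSMul IG I ∞ G M]
    -- the quotient manifold `B = M / G`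
    {EB : Type*} [NormedAddCommGroup EB] [NormedSpace ℝ EB] [FiniteDimensional ℝ EB]
    {HB : Type*} [TopologicalSpace HB] (IB : ModelWithCorners ℝ EB HB) [IB.Boundaryless]
    {B : Type*} [TopologicalSpace B] [ChartedSpace HB B] [IsManifold IB ∞ B]
    (π : M → B) (hπ : IsPrincipalBundle IG G I IB π)
    (ϖ : PrincipalConnection IG G I M)
    -- a vector field on `T(M / G)` and an un-reduction of it, along `Tπ`, on `TM`
    (Γbar : (w : TangentBundle IB B) → TangentSpace IB.tangent w)
    (hΓbar : IsSmoothVectorField IB.tangent Γbar)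
    (Γ : (v : TangentBundle I M) → TangentSpace I.tangent v)
    (hΓ : IsSmoothVectorField I.tangent Γ)
    (hunred : IsUnreduction I.tangent IB.tangent (tangentMap I IB π) Γ Γbar) :
    (IsSODE I Γ → IsSODE IB Γbar) ∧
    (IsSODE IB Γbar → (IsSODE I Γ ↔ ∀ v : TangentBundle I M,
      ϖ.verticalForm v (Γ v) = ϖ.form v.proj v.2)) ∧
    (IsSODE IB Γbar → (IsSODE I Γ ↔ ∀ v : TangentBundle I M,
      ϖ.verticalProjection v (Γ v) = ϖ.fieldX v)) := by
  have : CompleteSpace E := FiniteDimensional.complete ℝ E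
  have : CompleteSpace EB := FiniteDimensional.complete ℝ EB
  have hsmooth := hπ.contMDiff
  have hproj : ∀ v : TangentBundle I M,
      mfderiv IB.tangent IB (Bundle.TotalSpace.proj : TangentBundle IB B → B) (tangentMap I IB π v)
          (Γbar (tangentMap I IB π v)) =
        mfderiv I IB π v.proj
          (mfderiv I.tangent I (Bundle.TotalSpace.proj : TangentBundle I M → M) v (Γ v)) := by
    intro v
    have hT : MDifferentiableAt I.tangent IB.tangent (tangentMap I IB π) v :=
      (hsmooth.contMDiff_tangentMap (m := ∞) le_rfl v).mdifferentiableAt (by simp)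
    rw [← mfderiv_proj_mfderiv_tangentMap hsmooth v (Γ v), hunred.mfderiv_apply hΓ hT]
  have hform : IsSODE IB Γbar → (IsSODE I Γ ↔ ∀ v : TangentBundle I M,
      ϖ.verticalForm v (Γ v) = ϖ.form v.proj v.2) := by
    intro hbar
    rw [isSODE_iff_mfderiv_proj hΓ]
    refine ⟨fun h v => congrArg (ϖ.form v.proj) (h v), fun h v => ?_⟩
    exact ϖ.eq_of_mfderiv_eq_of_form_eq hπ
      ((hproj v).symm.trans (hbar.mfderiv_proj hΓbar (tangentMap I IB π v))) (h v)
  refine ⟨fun h => isSODE_of_mfderiv_proj fun w => ?_, hform, fun hbar => ?_⟩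
  -- Relatedness controls `Γbar` only on the image of `Tπ`, which is all of `TB`.
  · obtain ⟨v, rfl⟩ := hπ.tangentMap_surjective w
    rw [hproj v, h.mfderiv_proj hΓ v]
    rfl
  · simp only [ϖ.verticalProjection_eq_fieldX_iff]
    exact hform hbar
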